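/- Let $d\ge 2$ and $D\ge 1$ be integers and let $C>0$ be a real number. For real $Y>0$ let $S(Y;S_d)$ be the set of all monic polynomials $$f(x)=x^d+c_1x^{d-1}+\cdots+c_d\in\mathbb{Q}[x]$$ such that $Dc_i\in\mathbb{Z}$ and $|c_i|\le (CY)^i$ for $1\le i\le d$, and such that $\mathbb{Q}[x]/(f(x))$ is a field and the Galois group of $f$ over $\mathbb{Q}$ (the Galois group of its splitting field) is isomorphic to the symmetric group $S_d$. For a number field $K$ of degree $d$ over $\mathbb{Q}$, with discriminant $\mathrm{Disc}(K)$, let $$M_K(Y):=\#\{f\in S(Y;S_d) : \mathbb{Q}[x]/(f(x))\simeq K\}.$$ Then there is a constant $A>0$, depending only on $d$, $D$ and $C$, such that for every number field $K$ of degree $d$ and every real $Y>0$ the number $M_K(Y)$ is finite and $$M_K(Y)\le A\cdot\max\left(Y^{d}\,|\mathrm{Disc}(K)|^{-1/2},\ Y^{d/2}\right).$$ -/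

import Mathlib

open Polynomial

/-- The set of polynomials `f = x^d + c₁ x^(d-1) + ⋯ + c_d` with rational coefficients, with common
denominator dividing `D`, with `|cᵢ| ≤ (C Y)^i` for `1 ≤ i ≤ d`, which are irreducible over `ℚ`
(that is, `ℚ[x]/(f)` is a field) with Galois group isomorphic to the symmetric group `S_d`. -/
def boundedSdPolynomials (d D : ℕ) (C Y : ℝ) : Set ℚ[X] :=
  {f | f.Monic ∧ f.natDegree = d ∧
    (∀ j, ∃ a : ℤ, (D : ℚ) * f.coeff j = a) ∧
    (∀ i, 1 ≤ i → i ≤ d → |((f.coeff (d - i) : ℚ) : ℝ)| ≤ (C * Y) ^ i) ∧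
    Irreducible f ∧
    Nonempty (f.Gal ≃* Equiv.Perm (Fin d))}

/-- The polynomials of `boundedSdPolynomials d D C Y` that cut out the field `K`, that is, for which
`ℚ[x]/(f)` is isomorphic to `K`. -/
def polynomialsCuttingOut (K : Type*) [Field K] (d D : ℕ) (C Y : ℝ) : Set ℚ[X] :=
  {f | f ∈ boundedSdPolynomials d D C Y ∧ Nonempty (AdjoinRoot f ≃+* K)}

/-- The multiplicity `M_K(Y)`: the number of polynomials in the bounded family that cut out `K`. -/
noncomputable def fieldMultiplicity (K : Type*) [Field K] (d D : ℕ) (C Y : ℝ) : ℕ :=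
  (polynomialsCuttingOut K d D C Y).ncard

/-!
A polynomial `f` cutting out `K` is the minimal polynomial of some `α : K`, and it is recovered
from the algebraic integer `D α`. The roots of `f` are bounded by `2 C Y`
(`norm_le_two_mul_of_isRoot`), so `M_K(Y)` is at most the number `N(Z)` of `x ∈ 𝓞 K` whose absolute
values at the infinite places are all less than `Z = 4 D C Y`
(`finite_and_fieldMultiplicity_le_ncard_shortIntegers`). If `Z < 1` such an `x` vanishes and there
is no `f`. For `Z ≥ 1` there are two cases. Write `k(T)` for the dimension over `ℚ` of the span of
the integers shorter than `T`.

If `k(Z) = d`, the mixed space has a basis of lattice vectors shorter than `Z`. Every translate of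
the lattice then has at least `N(Z)` points in the ball of radius `(d + 1) Z`, and comparing volumes
gives `N(Z) ≪ Z ^ d / √|disc K|` (`ncard_shortIntegers_mul_sqrt_discr_le`).

If `k(Z) < d`, consider `S` and `T` with `S T ≤ Z`. The products of integers shorter than `S` with
integers shorter than `T` are shorter than `Z`, so they do not span `K`. Since `K` is a field, this
forces `k(S) + k(T) ≤ d` (`finrank_add_finrank_le_of_mul_le`). For the successive minima
`m_0 ≤ ⋯ ≤ m_{d-1} = Z`, cut off at `Z`, this says `m_j m_{d-1-j} ≥ Z`. A packing argument
(`ncard_shortVectors_le`) gives `N(T) ≤ (3 T / t) ^ k(T) N(t)`; applied between consecutive minima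
it yields `N(Z) ≪ ∏ Z / m_j`. Pairing `j` with `d - 1 - j` gives `N(Z) ^ 2 ≪ Z ^ d`
(`sq_le_of_rank_add_rank_le`, `ncard_shortIntegers_sq_le`).
-/

/-! ### Separated sets and the growth of the number of short vectors -/

open MeasureTheory Metric Module in
theorem card_le_of_pairwise_separated {α V : Type*} [NormedAddCommGroup V] [NormedSpace ℝ V]
    [FiniteDimensional ℝ V] (s : Finset α) (v : α → V) {t T : ℝ} (ht : 0 < t) (htT : t ≤ T)
    (hs : ∀ a ∈ s, ‖v a‖ < T) (h : (s : Set α).Pairwise fun a b ↦ t ≤ ‖v a - v b‖) :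
    (s.card : ℝ) ≤ (3 * T / t) ^ finrank ℝ V := by
  borelize V
  let μ : Measure V := Measure.addHaar
  have hδ : 0 < t / 2 := by positivity
  have hρ : 0 < 3 * T / 2 := by linarith
  have hdisj : (s : Set α).Pairwise (Function.onFun Disjoint fun a ↦ ball (v a) (t / 2)) := by
    intro a ha b hb hab
    apply ball_disjoint_ball
    rw [dist_eq_norm]
    linarith [h ha hb hab]
  have hsub : (⋃ a ∈ s, ball (v a) (t / 2)) ⊆ ball (0 : V) (3 * T / 2) := by
    refine Set.iUnion₂_subset fun a ha ↦ ball_subset_ball' ?_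
    rw [dist_zero_right]
    linarith [hs a ha]
  have hvol : (s.card : ENNReal) * ENNReal.ofReal ((t / 2) ^ finrank ℝ V) * μ (ball 0 1) ≤
      ENNReal.ofReal ((3 * T / 2) ^ finrank ℝ V) * μ (ball 0 1) := by
    have := measure_mono (μ := μ) hsub
    rw [measure_biUnion_finset hdisj fun a _ ↦ measurableSet_ball] at this
    simpa only [μ.addHaar_ball_of_pos _ hδ, μ.addHaar_ball_of_pos _ hρ, Finset.sum_const,
      nsmul_eq_mul, mul_assoc] using this
  rw [ENNReal.mul_le_mul_iff_left (measure_ball_pos _ _ zero_lt_one).ne' measure_ball_lt_top.ne]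
    at hvol
  have hreal := ENNReal.toReal_le_of_le_ofReal (pow_nonneg hρ.le _) hvol
  rwa [ENNReal.toReal_mul, ENNReal.toReal_natCast, ENNReal.toReal_ofReal (by positivity),
    ← le_div_iff₀ (by positivity), ← div_pow, div_div_div_cancel_right₀ two_ne_zero] at hreal

section ShortVectors

variable {F E : Type*} [AddCommGroup F] [NormedAddCommGroup E]

/-- The elements of the additive group `Λ` whose image under `ι` has norm less than `T`. -/
def shortVectors (Λ : AddSubgroup F) (ι : F →+ E) (T : ℝ) : Set F :=
  {x | x ∈ Λ ∧ ‖ι x‖ < T}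

theorem shortVectors_mono (Λ : AddSubgroup F) (ι : F →+ E) : Monotone (shortVectors Λ ι) :=
  fun _ _ h _ hx ↦ ⟨hx.1, hx.2.trans_le h⟩

theorem exists_lt_shortVectors_subset (Λ : AddSubgroup F) (ι : F →+ E)
    (hfin : ∀ T, (shortVectors Λ ι T).Finite) (T : ℝ) :
    ∃ T' < T, shortVectors Λ ι T ⊆ shortVectors Λ ι T' := by
  have h : ∀ᶠ T' in nhdsWithin T (Set.Iio T), ∀ x ∈ shortVectors Λ ι T, ‖ι x‖ < T' :=
    (Filter.eventually_all_finite (hfin T)).2 fun x hx ↦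
      (eventually_gt_nhds hx.2).filter_mono nhdsWithin_le_nhds
  obtain ⟨T', hT', hlt⟩ := (h.and self_mem_nhdsWithin).exists
  exact ⟨T', hlt, fun x hx ↦ ⟨hx.1, hT' x hx⟩⟩

variable [Module ℚ F] [NormedSpace ℝ E]

theorem map_mem_span_real_of_mem_span_rat (ι : F →+ E) {b : Set F} {x : F}
    (hx : x ∈ Submodule.span ℚ b) : ι x ∈ Submodule.span ℝ (ι '' b) := by
  induction hx using Submodule.span_induction with
  | mem x h => exact Submodule.subset_span ⟨x, h, rfl⟩
  | zero => simp
  | add x y _ _ hx hy => rw [map_add]; exact add_mem hx hy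
  | smul c x _ hx =>
    have := map_ratCast_smul ι ℚ ℝ c x
    rw [Rat.cast_id] at this
    rw [this]
    exact Submodule.smul_mem _ _ hx

theorem finrank_span_real_image_le (ι : F →+ E) {X : Set F} (hX : X.Finite) :
    Module.finrank ℝ (Submodule.span ℝ (ι '' X)) ≤ X.finrank ℚ := by
  obtain ⟨b, hbX, hspan, hli⟩ := exists_linearIndependent ℚ X
  have : Fintype b := (hX.subset hbX).fintype
  have : Fintype (ι '' b) := ((hX.subset hbX).image ι).fintype
  have hle : Submodule.span ℝ (ι '' X) ≤ Submodule.span ℝ (ι '' b) := by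
    rw [Submodule.span_le]
    rintro _ ⟨x, hx, rfl⟩
    exact map_mem_span_real_of_mem_span_rat ι (hspan ▸ Submodule.subset_span hx)
  have : FiniteDimensional ℝ (Submodule.span ℝ (ι '' b)) :=
    FiniteDimensional.span_of_finite ℝ (Set.toFinite _)
  calc Module.finrank ℝ (Submodule.span ℝ (ι '' X))
      ≤ Module.finrank ℝ (Submodule.span ℝ (ι '' b)) := Submodule.finrank_mono hle
    _ ≤ (ι '' b).ncard := by
      rw [Set.ncard_eq_toFinset_card']; exact finrank_span_le_card _
    _ ≤ b.ncard := Set.ncard_image_le (Set.toFinite _)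
    _ = X.finrank ℚ := by
      rw [Set.ncard_eq_toFinset_card', Set.finrank, ← hspan, finrank_span_set_eq_card hli]

/-- Growth of the number of short vectors. A maximal `t`-separated set of vectors shorter than `T`
has at most `(3 T / t) ^ k` elements, `k` being the rank of these vectors, and every vector shorter
than `T` differs from one of them by a vector shorter than `t`. -/
theorem ncard_shortVectors_le (Λ : AddSubgroup F) (ι : F →+ E)
    (hfin : ∀ T, (shortVectors Λ ι T).Finite) {t T : ℝ} (ht : 0 < t) (htT : t ≤ T) :
    ((shortVectors Λ ι T).ncard : ℝ) ≤
      (3 * T / t) ^ (shortVectors Λ ι T).finrank ℚ * (shortVectors Λ ι t).ncard := by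
  classical
  set X := shortVectors Λ ι T
  have hXfin : Finite X := hfin T
  let V := Submodule.span ℝ (ι '' X)
  have : FiniteDimensional ℝ V := FiniteDimensional.span_of_finite ℝ ((hfin T).image ι)
  let v : X → V := fun x ↦ ⟨ι x, Submodule.subset_span ⟨x, x.2, rfl⟩⟩
  obtain ⟨P, hP⟩ := (Set.toFinite
    {P : Finset X | (P : Set X).Pairwise fun a b ↦ t ≤ ‖v a - v b‖}).exists_maximal
    ⟨∅, by simp⟩
  have hPcard : (P.card : ℝ) ≤ (3 * T / t) ^ X.finrank ℚ := by
    refine (card_le_of_pairwise_separated P v ht htT (fun a _ ↦ a.2.2) hP.prop).trans ?_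
    exact pow_le_pow_right₀ (by rw [le_div_iff₀ ht]; linarith)
      (finrank_span_real_image_le ι (hfin T))
  have hcover : ∀ x : X, ∃ p ∈ P, ‖ι x - ι p‖ < t := by
    intro x
    by_contra! hx
    have hxP : x ∉ P := fun h ↦ by simpa using (hx x h).trans_lt' ht
    refine hxP (hP.le_of_ge (y := insert x P) ?_ (Finset.subset_insert x P)
      (Finset.mem_insert_self x P))
    rw [Set.mem_ofPred_eq, Finset.coe_insert]
    refine hP.prop.insert fun b hb _ ↦ ⟨hx b hb, ?_⟩
    rw [norm_sub_rev]
    exact hx b hb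
  have hsub : (hfin T).toFinset ⊆
      P.biUnion fun p ↦ (hfin t).toFinset.image fun y ↦ (p : F) + y := by
    intro x hx
    rw [Set.Finite.mem_toFinset] at hx
    obtain ⟨p, hp, hlt⟩ := hcover ⟨x, hx⟩
    refine Finset.mem_biUnion.2 ⟨p, hp, Finset.mem_image.2 ⟨x - p, ?_, by abel⟩⟩
    rw [Set.Finite.mem_toFinset]
    exact ⟨Λ.sub_mem hx.1 p.2.1, by rwa [map_sub]⟩
  have hcard : X.ncard ≤ P.card * (shortVectors Λ ι t).ncard := by
    rw [Set.ncard_eq_toFinset_card _ (hfin T), Set.ncard_eq_toFinset_card _ (hfin t)]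
    exact (Finset.card_le_card hsub).trans (Finset.card_biUnion_le_card_mul _ _ _
      fun p _ ↦ Finset.card_image_le)
  calc (X.ncard : ℝ) ≤ P.card * (shortVectors Λ ι t).ncard := by exact_mod_cast hcard
    _ ≤ _ := by gcongr

end ShortVectors

/-! ### Products of subspaces of a field -/

/-- If the products of elements of `A` and `B` do not span `L`, a nonzero linear form `φ` kills
them, and `a ↦ φ (a * ·)` embeds `A` into the annihilator of `B`. -/
theorem finrank_add_finrank_le_of_mul_le {k L : Type*} [Field k] [Field L] [Algebra k L]
    [FiniteDimensional k L] (A B W : Submodule k L) (hW : W < ⊤)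
    (h : ∀ a ∈ A, ∀ b ∈ B, a * b ∈ W) :
    Module.finrank k A + Module.finrank k B ≤ Module.finrank k L := by
  obtain ⟨φ, hφ, hWφ⟩ := Submodule.exists_le_ker_of_lt_top W hW
  let g : L →ₗ[k] Module.Dual k L := (LinearMap.mul k L).compr₂ φ
  have hg : Function.Injective g := by
    rw [injective_iff_map_eq_zero]
    intro a ha
    by_contra ha0
    refine hφ (LinearMap.ext fun y ↦ ?_)
    have := LinearMap.congr_fun ha (a⁻¹ * y)
    simpa [g, mul_inv_cancel_left₀ ha0] using this
  have hle : A.map g ≤ B.dualAnnihilator := by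
    rintro _ ⟨a, ha, rfl⟩
    rw [Submodule.mem_dualAnnihilator]
    exact fun b hb ↦ hWφ (h a ha b hb)
  have h1 := Submodule.finrank_mono hle
  rw [← (Submodule.equivMapOfInjective g hg A).finrank_eq] at h1
  have h2 := Subspace.finrank_add_finrank_dualAnnihilator_eq B
  omega

/-! ### Successive minima -/

/-- The numerical core of the argument with successive minima. Here `N T` stands for the number of
vectors shorter than `T` and `k T` for their rank; the minima are the last points
`m j = sup {T ≤ Z | k T ≤ j}` at which the rank does not exceed `j`. Growth between consecutive
minima bounds `N Z` by `∏ Z / m j`, and `m j * m (d - 1 - j) ≥ Z`. -/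
theorem sq_le_of_rank_add_rank_le (N k : ℝ → ℕ) (d : ℕ) {Z : ℝ} (hZ : 1 ≤ Z)
    (hmono : Monotone k) (hleft : ∀ T, ∃ T' < T, k T ≤ k T') (hk1 : k 1 = 0)
    (hN0 : ∀ T, k T = 0 → N T ≤ 1)
    (hgrow : ∀ t T, 0 < t → t ≤ T → (N T : ℝ) ≤ (3 * T / t) ^ k T * N t)
    (hkZ : k Z < d)
    (hpair : ∀ S T, 1 ≤ S → 1 ≤ T → S * T ≤ Z → k S + k T ≤ d) :
    (N Z : ℝ) ^ 2 ≤ (3 ^ d ^ 2) ^ 2 * Z ^ d := by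
  let s : ℕ → Set ℝ := fun j ↦ {T | T ≤ Z ∧ k T ≤ j}
  let m : ℕ → ℝ := fun j ↦ sSup (s j)
  have hbdd : ∀ j, BddAbove (s j) := fun j ↦ ⟨Z, fun T hT ↦ hT.1⟩
  have h1s : ∀ j, (1 : ℝ) ∈ s j := fun j ↦ ⟨hZ, by omega⟩
  have hm1 : ∀ j, 1 ≤ m j := fun j ↦ le_csSup (hbdd j) (h1s j)
  have hmZ : ∀ j, m j ≤ Z := fun j ↦ csSup_le ⟨1, h1s j⟩ fun T hT ↦ hT.1
  have hm0 : ∀ j, 0 < m j := fun j ↦ one_pos.trans_le (hm1 j)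
  have hkm : ∀ j, k (m j) ≤ j := by
    intro j
    obtain ⟨T', hT', hle⟩ := hleft (m j)
    obtain ⟨T, hT, hlt⟩ := exists_lt_of_lt_csSup ⟨1, h1s j⟩ hT'
    exact hle.trans ((hmono hlt.le).trans hT.2)
  have hmmono : ∀ j, m j ≤ m (j + 1) := fun j ↦
    csSup_le_csSup (hbdd _) ⟨1, h1s j⟩ fun T hT ↦ ⟨hT.1, hT.2.trans (Nat.le_succ j)⟩
  have hgt : ∀ j T, T ≤ Z → m j < T → j < k T := by
    intro j T hTZ hT
    by_contra! hle
    exact hT.not_ge (le_csSup (hbdd j) ⟨hTZ, hle⟩)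
  have hmtop : m (d - 1) = Z :=
    le_antisymm (hmZ _) (le_csSup (hbdd _) ⟨le_rfl, by omega⟩)
  -- Between `m j` and `m (j + 1)` the rank is at most `j + 1`.
  have hNm : ∀ j, (N (m j) : ℝ) ≤ 3 ^ j ^ 2 * ∏ l ∈ Finset.range j, m j / m l := by
    intro j
    induction j with
    | zero => simpa using hN0 _ (Nat.le_zero.1 (hkm 0))
    | succ j ih =>
      have hq : 1 ≤ m (j + 1) / m j := (one_le_div (hm0 j)).2 (hmmono j)
      calc (N (m (j + 1)) : ℝ)
          ≤ (3 * m (j + 1) / m j) ^ k (m (j + 1)) * N (m j) := hgrow _ _ (hm0 j) (hmmono j)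
        _ ≤ (3 * m (j + 1) / m j) ^ (j + 1) * (3 ^ j ^ 2 * ∏ l ∈ Finset.range j, m j / m l) := by
          have : 1 ≤ 3 * m (j + 1) / m j := by rw [mul_div_assoc]; linarith
          have := pow_le_pow_right₀ this (hkm (j + 1))
          gcongr
        _ = 3 ^ (j + 1 + j ^ 2) *
            ∏ l ∈ Finset.range (j + 1), m (j + 1) / m l := by
          rw [Finset.prod_range_succ, mul_div_assoc, mul_pow, pow_add, pow_succ (m (j + 1) / m j)]
          have : ∏ l ∈ Finset.range j, m (j + 1) / m l =
              (m (j + 1) / m j) ^ j * ∏ l ∈ Finset.range j, m j / m l := by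
            rw [← Finset.card_range j, ← Finset.prod_const, Finset.card_range,
              ← Finset.prod_mul_distrib]
            refine Finset.prod_congr rfl fun l _ ↦ ?_
            rw [div_mul_div_cancel₀ (hm0 j).ne']
          rw [this]
          ring
        _ ≤ 3 ^ (j + 1) ^ 2 * ∏ l ∈ Finset.range (j + 1), m (j + 1) / m l := by
          have : 0 ≤ ∏ l ∈ Finset.range (j + 1), m (j + 1) / m l :=
            Finset.prod_nonneg fun l _ ↦ (div_pos (hm0 _) (hm0 _)).le
          have h3 : (3 : ℝ) ^ (j + 1 + j ^ 2) ≤ 3 ^ (j + 1) ^ 2 :=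
            pow_le_pow_right₀ (by norm_num) (by nlinarith)
          gcongr
  have hNZ : (N Z : ℝ) ≤ 3 ^ d ^ 2 * ∏ l ∈ Finset.range d, Z / m l := by
    have hd : d = d - 1 + 1 := by omega
    have := hNm (d - 1)
    rw [hmtop] at this
    rw [hd, Finset.prod_range_succ, hmtop, div_self (by linarith), mul_one]
    refine this.trans ?_
    have h0 : 0 ≤ ∏ l ∈ Finset.range (d - 1), Z / m l :=
      Finset.prod_nonneg fun l _ ↦ (div_pos (by linarith) (hm0 _)).le
    have h3 : (3 : ℝ) ^ (d - 1) ^ 2 ≤ 3 ^ (d - 1 + 1) ^ 2 :=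
      pow_le_pow_right₀ (by norm_num) (by nlinarith)
    gcongr
  have hmm : ∀ j < d, Z ≤ m j * m (d - 1 - j) := by
    intro j hj
    by_contra! hlt
    -- Enlarge both minima slightly, keeping the product below `Z`.
    have hcont : Filter.Tendsto (fun ε : ℝ ↦ (m j + ε) * (m (d - 1 - j) + ε))
        (nhdsWithin 0 (Set.Ioi 0)) (nhds ((m j + 0) * (m (d - 1 - j) + 0))) :=
      (Continuous.tendsto (by fun_prop) 0).mono_left nhdsWithin_le_nhds
    rw [add_zero, add_zero] at hcont
    obtain ⟨ε, hε, hε0⟩ :=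
      ((hcont.eventually_lt_const hlt).and self_mem_nhdsWithin).exists
    have hε0 : 0 < ε := hε0
    have ha := hm1 j
    have hb := hm1 (d - 1 - j)
    have h1 := hgt j (m j + ε) (by nlinarith) (by linarith)
    have h2 := hgt (d - 1 - j) (m (d - 1 - j) + ε) (by nlinarith) (by linarith)
    have h3 := hpair (m j + ε) (m (d - 1 - j) + ε) (by linarith) (by linarith) hε.le
    omega
  calc (N Z : ℝ) ^ 2 ≤ (3 ^ d ^ 2 * ∏ l ∈ Finset.range d, Z / m l) ^ 2 := by gcongr
    _ = (3 ^ d ^ 2) ^ 2 * ∏ l ∈ Finset.range d, Z / m l * (Z / m (d - 1 - l)) := by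
      rw [mul_pow, Finset.prod_mul_distrib, Finset.prod_range_reflect (fun l ↦ Z / m l) d, sq
        (∏ l ∈ Finset.range d, Z / m l)]
    _ ≤ (3 ^ d ^ 2) ^ 2 * ∏ _l ∈ Finset.range d, Z := by
      gcongr with l hl
      · intro l _
        have := hm0 l
        have := hm0 (d - 1 - l)
        positivity
      · rw [div_mul_div_comm, div_le_iff₀ (mul_pos (hm0 _) (hm0 _))]
        exact mul_le_mul_of_nonneg_left (hmm l (Finset.mem_range.1 hl)) (by linarith)
    _ = (3 ^ d ^ 2) ^ 2 * Z ^ d := by simp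

/-! ### Lattice points in a ball with a spanning set of short vectors -/

open MeasureTheory Metric Module in
/-- If lattice vectors of length less than `Z` span the ambient space, then every translate of the
lattice meets the ball of radius `n Z`, hence has at least `#S` points in the ball of radius
`(n + 1) Z`; integrating over a fundamental domain bounds `#S` by a quotient of volumes. -/
theorem card_mul_measure_fundamentalDomain_le {ι E : Type*} [Finite ι] [NormedAddCommGroup E]
    [NormedSpace ℝ E] [FiniteDimensional ℝ E] [MeasurableSpace E] [BorelSpace E] (μ : Measure E)
    [μ.IsAddHaarMeasure] (b : Basis ι ℝ E) (S : Finset E) {Z : ℝ}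
    (hSb : ∀ x ∈ S, x ∈ Submodule.span ℤ (Set.range b)) (hSZ : ∀ x ∈ S, ‖x‖ < Z)
    (hspan : Submodule.span ℝ (S : Set E) = ⊤) :
    S.card * μ (ZSpan.fundamentalDomain b) ≤ μ (ball 0 ((finrank ℝ E + 1) * Z)) := by
  set L := Submodule.span ℤ (Set.range b) with hL
  set R : ℝ := (finrank ℝ E + 1) * Z with hR
  have : VAddInvariantMeasure L E μ := inferInstanceAs <| VAddInvariantMeasure L.toAddSubgroup E μ
  -- Round the coordinates of `x` in a basis of short lattice vectors.
  have hclose : ∀ x : E, ∃ g ∈ L, ‖g + x‖ ≤ finrank ℝ E * Z := by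
    intro x
    obtain ⟨c, hcS, hcspan, hli⟩ := exists_linearIndependent ℝ (S : Set E)
    have : Fintype c := (S.finite_toSet.subset hcS).fintype
    let B : Basis c ℝ E := Basis.mk hli (by rw [Subtype.range_coe, hcspan, hspan])
    refine ⟨-ZSpan.floor B x, L.neg_mem ?_, ?_⟩
    · refine (Submodule.span_le.2 ?_ : Submodule.span ℤ (Set.range B) ≤ L) (ZSpan.floor B x).2
      rintro _ ⟨i, rfl⟩
      rw [Basis.mk_apply]
      exact hSb _ (hcS i.2)
    · rw [neg_add_eq_sub, ← ZSpan.fract_apply]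
      refine (ZSpan.norm_fract_le B x).trans ?_
      rw [finrank_eq_card_basis B, ← nsmul_eq_mul]
      refine Finset.sum_le_card_nsmul _ _ _ fun i _ ↦ ?_
      rw [Basis.mk_apply]
      exact (hSZ _ (hcS i.2)).le
  have hcount : ∀ x : E,
      (S.card : ENNReal) ≤ ∑' g : L, (ball (0 : E) R).indicator 1 (g +ᵥ x) := by
    intro x
    obtain ⟨g, hg, hgx⟩ := hclose x
    let f : S → L := fun s ↦ ⟨s + g, L.add_mem (hSb s s.2) hg⟩
    have hf : Function.Injective f := fun s s' h ↦
      Subtype.ext (add_right_cancel (congrArg Subtype.val h))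
    refine le_trans ?_ (ENNReal.tsum_comp_le_tsum_of_injective hf _)
    have hone : ∀ s : S, (ball (0 : E) R).indicator (1 : E → ENNReal) (f s +ᵥ x) = 1 := by
      intro s
      refine Set.indicator_of_mem ?_ _
      rw [mem_ball_zero_iff]
      change ‖(s + g : E) + x‖ < R
      have h1 := norm_add_le (s : E) (g + x)
      have h2 := hSZ s s.2
      rw [add_assoc, hR]
      linarith
    simp [hone]
  calc S.card * μ (ZSpan.fundamentalDomain b)
      = ∫⁻ _x in ZSpan.fundamentalDomain b, (S.card : ENNReal) ∂μ := by
        rw [setLIntegral_const]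
    _ ≤ ∫⁻ x in ZSpan.fundamentalDomain b,
          ∑' g : L, (ball (0 : E) R).indicator 1 (g +ᵥ x) ∂μ := lintegral_mono hcount
    _ = ∑' g : L, ∫⁻ x in ZSpan.fundamentalDomain b,
          (ball (0 : E) R).indicator 1 (g +ᵥ x) ∂μ := by
        refine lintegral_tsum fun g ↦ Measurable.aemeasurable ?_
        exact (measurable_one.indicator measurableSet_ball).comp (measurable_const_vadd g)
    _ = ∫⁻ x, (ball (0 : E) R).indicator 1 x ∂μ :=
        ((ZSpan.isAddFundamentalDomain b μ).lintegral_eq_tsum'' _).symm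
    _ = μ (ball 0 R) := lintegral_indicator_one measurableSet_ball

/-! ### Integers of bounded size in a number field -/

section NumberField

open scoped Classical
open NumberField NumberField.InfinitePlace NumberField.mixedEmbedding

variable (K : Type*) [Field K] [NumberField K]

/-- The algebraic integers of `K` all of whose absolute values at the infinite places are less than
`T`, as short vectors of the lattice `𝓞 K` for the sup norm on the mixed space. -/
def shortIntegers (T : ℝ) : Set K :=
  shortVectors (algebraMap (𝓞 K) K).range.toAddSubgroup (mixedEmbedding K).toAddMonoidHom T

variable {K} in
theorem mem_shortIntegers {T : ℝ} {x : K} :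
    x ∈ shortIntegers K T ↔ IsIntegral ℤ x ∧ ∀ w : InfinitePlace K, w x < T := by
  refine and_congr ⟨?_, fun h ↦ ⟨⟨x, h⟩, rfl⟩⟩ ?_
  · rintro ⟨y, rfl⟩
    exact y.2
  · change ‖mixedEmbedding K x‖ < T ↔ _
    rw [mixedEmbedding.norm_eq_sup'_normAtPlace, Finset.sup'_lt_iff]
    simp [normAtPlace_apply]

theorem finite_shortIntegers (T : ℝ) : (shortIntegers K T).Finite := by
  refine (Embeddings.finite_of_norm_le K ℂ T).subset fun x hx ↦ ?_
  rw [mem_shortIntegers] at hx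
  exact ⟨hx.1, fun φ ↦ (hx.2 (InfinitePlace.mk φ)).le⟩

theorem shortIntegers_mono : Monotone (shortIntegers K) :=
  shortVectors_mono _ _

/-- A nonzero algebraic integer has norm at least `1`, so not all its absolute values are smaller
than `1`. -/
theorem shortIntegers_one_subset : shortIntegers K 1 ⊆ {0} := by
  intro x hx
  rw [mem_shortIntegers] at hx
  by_contra h0
  obtain ⟨w⟩ := (inferInstance : Nonempty (InfinitePlace K))
  have := one_le_of_lt_one (w := w) (a := ⟨x, hx.1⟩)
    (fun h ↦ h0 (congrArg (algebraMap (𝓞 K) K) h)) fun z _ ↦ hx.2 z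
  exact (hx.2 w).not_ge this

/-- Since `𝓞 K` is a ring, short integers of lengths `S` and `T` multiply into the span of the
integers shorter than `S T`. -/
theorem finrank_shortIntegers_add_le {S T Z : ℝ} (hST : S * T ≤ Z)
    (hZ : (shortIntegers K Z).finrank ℚ < Module.finrank ℚ K) :
    (shortIntegers K S).finrank ℚ + (shortIntegers K T).finrank ℚ ≤ Module.finrank ℚ K := by
  refine finrank_add_finrank_le_of_mul_le _ _ (Submodule.span ℚ (shortIntegers K Z)) ?_ ?_
  · exact lt_top_iff_ne_top.2 fun h ↦ by
      rw [Set.finrank, h, finrank_top] at hZ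
      exact hZ.false
  · intro a ha b hb
    have hab := Submodule.mul_mem_mul ha hb
    rw [Submodule.span_mul_span] at hab
    refine Submodule.span_mono ?_ hab
    rintro _ ⟨x, hx, y, hy, rfl⟩
    rw [mem_shortIntegers] at hx hy
    refine mem_shortIntegers.2 ⟨hx.1.mul hy.1, fun w ↦ ?_⟩
    change w (x * y) < Z
    rw [map_mul]
    exact (mul_lt_mul'' (hx.2 w) (hy.2 w) (apply_nonneg _ _) (apply_nonneg _ _)).trans_le hST

/-- When the integers shorter than `Z` do not span `K`, there are `O(Z ^ (d / 2))` of them. -/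
theorem ncard_shortIntegers_sq_le {Z : ℝ} (hZ : 1 ≤ Z)
    (hrank : (shortIntegers K Z).finrank ℚ < Module.finrank ℚ K) :
    ((shortIntegers K Z).ncard : ℝ) ^ 2 ≤
      (3 ^ Module.finrank ℚ K ^ 2) ^ 2 * Z ^ Module.finrank ℚ K := by
  have hmono : ∀ {S T : Set K}, S ⊆ T → S.finrank ℚ ≤ T.finrank ℚ := fun h ↦
    Submodule.finrank_mono (Submodule.span_mono h)
  refine sq_le_of_rank_add_rank_le (fun T ↦ (shortIntegers K T).ncard)
    (fun T ↦ (shortIntegers K T).finrank ℚ) _ hZ ?_ ?_ ?_ ?_ ?_ hrank ?_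
  · exact fun S T h ↦ hmono (shortIntegers_mono K h)
  · intro T
    obtain ⟨T', hlt, h⟩ := exists_lt_shortVectors_subset (algebraMap (𝓞 K) K).range.toAddSubgroup
      (mixedEmbedding K).toAddMonoidHom (finite_shortIntegers K) T
    exact ⟨T', hlt, hmono h⟩
  · have h := hmono (shortIntegers_one_subset K)
    have h0 : ({0} : Set K).finrank ℚ = 0 := by simp [Set.finrank]
    exact Nat.le_zero.1 (h.trans h0.le)
  · intro T hT
    have h : Submodule.span ℚ (shortIntegers K T) = ⊥ := Submodule.finrank_eq_zero.1 hT
    rw [Submodule.span_eq_bot] at h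
    exact (Set.ncard_le_ncard (t := {(0 : K)}) (fun x hx ↦ h x hx)).trans
      (Set.ncard_singleton _).le
  · exact fun t T ht htT ↦ ncard_shortVectors_le _ _ (finite_shortIntegers K) ht htT
  · exact fun S T _ _ h ↦ finrank_shortIntegers_add_le K h hrank

open MeasureTheory Metric in
theorem volume_ball_mixedSpace_le {R : ℝ} (hR : 0 ≤ R) :
    volume (ball (0 : mixedSpace K) R) ≤
      ENNReal.ofReal (2 ^ nrRealPlaces K * Real.pi ^ nrComplexPlaces K *
        R ^ Module.finrank ℚ K) := by
  lift R to NNReal using hR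
  have hsub : ball (0 : mixedSpace K) R ⊆ convexBodyLT K fun _ ↦ R := by
    intro x hx
    rw [mem_ball_zero_iff, Prod.norm_def, max_lt_iff] at hx
    refine ⟨fun w _ ↦ ?_, fun w _ ↦ ?_⟩
    · exact mem_ball_zero_iff.2 ((norm_le_pi_norm _ w).trans_lt hx.1)
    · exact mem_ball_zero_iff.2 ((norm_le_pi_norm _ w).trans_lt hx.2)
  refine (measure_mono hsub).trans (le_of_eq ?_)
  rw [convexBodyLT_volume, Finset.prod_pow_eq_pow_sum, sum_mult_eq,
    ← ENNReal.coe_mul, ← ENNReal.ofReal_coe_nnreal]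
  simp [convexBodyLTFactor]

open MeasureTheory Metric in
/-- When the integers shorter than `Z` span `K`, there are `O(Z ^ d / √|disc K|)` of them. -/
theorem ncard_shortIntegers_mul_sqrt_discr_le {Z : ℝ} (hZ : 0 ≤ Z)
    (hrank : (shortIntegers K Z).finrank ℚ = Module.finrank ℚ K) :
    (shortIntegers K Z).ncard * √|(discr K : ℝ)| ≤
      (4 * ((Module.finrank ℚ K + 1) * Z)) ^ Module.finrank ℚ K := by
  set d := Module.finrank ℚ K with hd
  have hfinrank : Module.finrank ℝ (mixedSpace K) = d := mixedEmbedding.finrank K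
  let S : Finset (mixedSpace K) := (finite_shortIntegers K Z).toFinset.image (mixedEmbedding K)
  have hScard : S.card = (shortIntegers K Z).ncard := by
    rw [Finset.card_image_of_injective _ (mixedEmbedding_injective K),
      Set.ncard_eq_toFinset_card _ (finite_shortIntegers K Z)]
  have htop : Submodule.span ℚ (shortIntegers K Z) = ⊤ :=
    Submodule.eq_top_of_finrank_eq hrank
  have hspan : Submodule.span ℝ (S : Set (mixedSpace K)) = ⊤ := by
    rw [eq_top_iff, ← (latticeBasis K).span_eq, Submodule.span_le]
    rintro _ ⟨i, rfl⟩
    rw [latticeBasis_apply]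
    have := map_mem_span_real_of_mem_span_rat (mixedEmbedding K).toAddMonoidHom
      (htop ▸ Submodule.mem_top : integralBasis K i ∈ Submodule.span ℚ (shortIntegers K Z))
    simpa [S] using this
  have hvol := card_mul_measure_fundamentalDomain_le volume (latticeBasis K) S (Z := Z)
    (fun x hx ↦ by
      obtain ⟨y, hy, rfl⟩ := Finset.mem_image.1 hx
      obtain ⟨⟨z, rfl⟩, -⟩ := (Set.Finite.mem_toFinset _).1 hy
      exact (mem_span_latticeBasis K).2 ⟨z, rfl⟩)
    (fun x hx ↦ by
      obtain ⟨y, hy, rfl⟩ := Finset.mem_image.1 hx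
      exact ((Set.Finite.mem_toFinset _).1 hy).2)
    hspan
  rw [hScard, hfinrank] at hvol
  have hreal := ENNReal.toReal_le_of_le_ofReal (by positivity)
    (hvol.trans (volume_ball_mixedSpace_le K (by positivity)))
  rw [volume_fundamentalDomain_latticeBasis] at hreal
  simp only [ENNReal.toReal_mul, ENNReal.toReal_natCast, ENNReal.toReal_pow, ENNReal.toReal_inv,
    ENNReal.toReal_ofNat, ENNReal.coe_toReal, Real.coe_sqrt, coe_nnnorm, Int.norm_eq_abs,
    inv_pow] at hreal
  -- The factor `2 ^ nrComplexPlaces K` is the denominator of the covolume of `𝓞 K`.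
  have hconst : (2 : ℝ) ^ nrComplexPlaces K * (2 ^ nrRealPlaces K * Real.pi ^ nrComplexPlaces K) ≤
      4 ^ d := by
    rw [hd, ← card_add_two_mul_card_eq_rank K, pow_add, pow_mul]
    calc (2 : ℝ) ^ nrComplexPlaces K * (2 ^ nrRealPlaces K * Real.pi ^ nrComplexPlaces K)
        = 2 ^ nrRealPlaces K * (2 * Real.pi) ^ nrComplexPlaces K := by rw [mul_pow]; ring
      _ ≤ 4 ^ nrRealPlaces K * (4 ^ 2) ^ nrComplexPlaces K := by
        have := Real.pi_le_four
        gcongr <;> linarith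
  calc (shortIntegers K Z).ncard * √|(discr K : ℝ)|
      = 2 ^ nrComplexPlaces K *
        ((shortIntegers K Z).ncard * ((2 ^ nrComplexPlaces K)⁻¹ * √|(discr K : ℝ)|)) := by
        field_simp
    _ ≤ 2 ^ nrComplexPlaces K * (2 ^ nrRealPlaces K * Real.pi ^ nrComplexPlaces K *
        ((d + 1) * Z) ^ d) := mul_le_mul_of_nonneg_left hreal (by positivity)
    _ = 2 ^ nrComplexPlaces K * (2 ^ nrRealPlaces K * Real.pi ^ nrComplexPlaces K) *
        ((d + 1) * Z) ^ d := by ring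
    _ ≤ 4 ^ d * ((d + 1) * Z) ^ d := by gcongr
    _ = (4 * ((d + 1) * Z)) ^ d := by rw [← mul_pow]

end NumberField

/-! ### From polynomials to integers -/

theorem norm_le_two_mul_of_isRoot {p : ℂ[X]} (hp : p.Monic) {B : ℝ} (hB : 0 ≤ B)
    (hcoeff : ∀ i, 1 ≤ i → i ≤ p.natDegree → ‖p.coeff (p.natDegree - i)‖ ≤ B ^ i)
    {z : ℂ} (hz : p.IsRoot z) : ‖z‖ ≤ 2 * B := by
  by_contra! hlt
  have hr : 0 < ‖z‖ := by linarith
  set d := p.natDegree with hd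
  have hsum : ∑ j ∈ Finset.range d, p.coeff j * z ^ j = -z ^ d := by
    have h := hz
    rw [IsRoot.def, eval_eq_sum_range, Finset.sum_range_succ, hp.coeff_natDegree, one_mul] at h
    exact eq_neg_of_add_eq_zero_left h
  have hle : ‖z‖ ^ d ≤ ∑ j ∈ Finset.range d, (‖z‖ / 2) ^ d * 2 ^ j := by
    rw [← norm_pow, ← norm_neg, ← hsum]
    refine (norm_sum_le _ _).trans (Finset.sum_le_sum fun j hj ↦ ?_)
    have hj : j < d := Finset.mem_range.1 hj
    have h1 := hcoeff (d - j) (by omega) (by omega)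
    rw [Nat.sub_sub_self hj.le] at h1
    calc ‖p.coeff j * z ^ j‖ ≤ (‖z‖ / 2) ^ (d - j) * ‖z‖ ^ j := by
          rw [norm_mul, norm_pow]
          gcongr
          exact h1.trans (pow_le_pow_left₀ hB (by linarith) _)
      _ = (‖z‖ / 2) ^ (d - j) * (‖z‖ / 2) ^ j * 2 ^ j := by
          rw [mul_assoc, ← mul_pow, div_mul_cancel₀ _ two_ne_zero]
      _ = (‖z‖ / 2) ^ d * 2 ^ j := by rw [← pow_add, Nat.sub_add_cancel hj.le]
  rw [← Finset.mul_sum, geom_sum_eq (by norm_num), div_pow, div_mul_eq_mul_div,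
    le_div_iff₀ (by positivity)] at hle
  have : 0 < ‖z‖ ^ d := by positivity
  norm_num at hle
  nlinarith

theorem isIntegral_mul_of_aeval_eq_zero {K : Type*} [Field K] [Algebra ℚ K] {D : ℕ} (hD : 1 ≤ D)
    {f : ℚ[X]} (hf : f.Monic) (hden : ∀ j, ∃ a : ℤ, (D : ℚ) * f.coeff j = a) {α : K}
    (hα : aeval α f = 0) : IsIntegral ℤ ((D : K) * α) := by
  have hD0 : (D : ℚ) ≠ 0 := by positivity
  have hlift : Polynomial.C (D : ℚ) * f ∈ lifts (Int.castRingHom ℚ) := by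
    rw [lifts_iff_coeff_lifts]
    intro j
    obtain ⟨a, ha⟩ := hden j
    exact ⟨a, by rw [coeff_C_mul, ha, eq_intCast]⟩
  obtain ⟨q, hq⟩ := (mem_lifts _).1 hlift
  have hlead : q.leadingCoeff = D := by
    have h := leadingCoeff_map_of_injective (f := Int.castRingHom ℚ) Int.cast_injective q
    rw [hq, leadingCoeff_mul, leadingCoeff_C, hf.leadingCoeff, mul_one, eq_intCast] at h
    exact_mod_cast h.symm
  have hroot : aeval α q = 0 := by
    rw [← aeval_map_algebraMap ℚ α q]
    change aeval α (q.map (Int.castRingHom ℚ)) = 0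
    rw [hq, map_mul, hα, mul_zero]
  have := isIntegral_leadingCoeff_smul q α hroot
  rw [hlead] at this
  simpa using this

open NumberField in
/-- A polynomial of the family which cuts out `K` is the minimal polynomial of some `α : K`, and
`D α` is an algebraic integer with all conjugates bounded by `2 D C Y`. -/
theorem exists_eq_minpoly_of_mem_polynomialsCuttingOut {K : Type*} [Field K] [NumberField K]
    {d D : ℕ} (hD : 1 ≤ D) {C Y : ℝ} (hC : 0 < C) (hY : 0 < Y) {f : ℚ[X]}
    (hf : f ∈ polynomialsCuttingOut K d D C Y) :
    ∃ α : K, f = minpoly ℚ α ∧ (D : K) * α ∈ shortIntegers K (4 * D * C * Y) := by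
  obtain ⟨⟨hmonic, hdeg, hden, hbound, hirr, -⟩, ⟨e⟩⟩ := hf
  have hα : aeval (e (AdjoinRoot.root f)) f = 0 := by
    rw [aeval_def, Subsingleton.elim (algebraMap ℚ K)
      ((e : AdjoinRoot f →+* K).comp (AdjoinRoot.of f))]
    change eval₂ _ ((e : AdjoinRoot f →+* K) (AdjoinRoot.root f)) f = 0
    rw [← hom_eval₂, AdjoinRoot.eval₂_root, map_zero]
  set α := e (AdjoinRoot.root f)
  have hD0 : (1 : ℝ) ≤ D := by exact_mod_cast hD
  refine ⟨α, minpoly.eq_of_irreducible_of_monic hirr hα hmonic, mem_shortIntegers.2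
    ⟨isIntegral_mul_of_aeval_eq_zero hD hmonic hden hα, fun w ↦ ?_⟩⟩
  have hroot : ‖w.embedding α‖ ≤ 2 * (C * Y) := by
    refine norm_le_two_mul_of_isRoot (p := f.map (algebraMap ℚ ℂ)) (hmonic.map _)
      (by positivity) ?_ ?_
    · intro i h1 hi
      rw [natDegree_map, hdeg] at hi ⊢
      rw [coeff_map, eq_ratCast, Complex.norm_ratCast]
      exact hbound i h1 hi
    · rw [IsRoot.def, eval_map, Subsingleton.elim (algebraMap ℚ ℂ)
        (w.embedding.comp (algebraMap ℚ K)), ← hom_eval₂, ← aeval_def, hα, map_zero]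
  rw [InfinitePlace.norm_embedding_eq] at hroot
  have hDw : w (D : K) = D := by
    rw [← InfinitePlace.norm_embedding_eq, map_natCast, Complex.norm_natCast]
  rw [map_mul, hDw]
  calc (D : ℝ) * w α ≤ D * (2 * (C * Y)) := by gcongr
    _ < 4 * D * C * Y := by
      have : 0 < D * (C * Y) := by positivity
      linarith

open NumberField in
theorem finite_and_fieldMultiplicity_le_ncard_shortIntegers {K : Type*} [Field K] [NumberField K]
    {d D : ℕ} (hD : 1 ≤ D) {C Y : ℝ} (hC : 0 < C) (hY : 0 < Y) :
    (polynomialsCuttingOut K d D C Y).Finite ∧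
      fieldMultiplicity K d D C Y ≤ (shortIntegers K (4 * D * C * Y)).ncard := by
  choose! α hαmin hα using fun f (hf : f ∈ polynomialsCuttingOut K d D C Y) ↦
    exists_eq_minpoly_of_mem_polynomialsCuttingOut hD hC hY hf
  have hD0 : (D : K) ≠ 0 := Nat.cast_ne_zero.2 (by omega)
  have hinj : Set.InjOn (fun f ↦ (D : K) * α f) (polynomialsCuttingOut K d D C Y) := by
    intro f hf g hg h
    rw [hαmin f hf, hαmin g hg, mul_left_cancel₀ hD0 h]
  exact ⟨Set.Finite.of_injOn hα hinj (finite_shortIntegers K _),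
    Set.ncard_le_ncard_of_injOn _ hα hinj (finite_shortIntegers K _)⟩

/-- For small `Y` there is no polynomial to count, as `α` would vanish. -/
theorem one_le_of_nonempty_polynomialsCuttingOut {K : Type*} [Field K] [NumberField K]
    {d D : ℕ} (hd : 2 ≤ d) (hD : 1 ≤ D) {C Y : ℝ} (hC : 0 < C) (hY : 0 < Y)
    (h : (polynomialsCuttingOut K d D C Y).Nonempty) : 1 ≤ 4 * D * C * Y := by
  obtain ⟨f, hf⟩ := h
  obtain ⟨α, hmin, hα⟩ := exists_eq_minpoly_of_mem_polynomialsCuttingOut hD hC hY hf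
  by_contra! hlt
  have h0 : (D : K) * α = 0 :=
    shortIntegers_one_subset K (shortIntegers_mono K hlt.le hα)
  have hα0 : α = 0 := (mul_eq_zero.1 h0).resolve_left (Nat.cast_ne_zero.2 (by omega))
  have hdeg := hf.1.2.1
  rw [hmin, hα0, minpoly.zero, natDegree_X] at hdeg
  omega

/-! ### The bound for the multiplicity -/

theorem mainTheorem9 (d : ℕ) (hd : 2 ≤ d) (D : ℕ) (hD : 1 ≤ D) (C : ℝ) (hC : 0 < C) :
    ∃ A : ℝ, 0 < A ∧
      ∀ (K : Type*) [Field K] [NumberField K], Module.finrank ℚ K = d →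
        ∀ Y : ℝ, 0 < Y →
          (polynomialsCuttingOut K d D C Y).Finite ∧
          (fieldMultiplicity K d D C Y : ℝ) ≤
            A * max (Y ^ d * |(NumberField.discr K : ℝ)| ^ (-(1 / 2) : ℝ)) (Y ^ ((d : ℝ) / 2)) := by
  have hD0 : (0 : ℝ) < D := by exact_mod_cast hD
  set c : ℝ := 4 * D * C with hc
  have hc0 : 0 < c := by positivity
  refine ⟨(4 * ((d + 1) * c)) ^ d + 3 ^ d ^ 2 * c ^ ((d : ℝ) / 2), by positivity, ?_⟩
  intro K _ _ hK Y hY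
  obtain ⟨hfin, hle⟩ :=
    finite_and_fieldMultiplicity_le_ncard_shortIntegers (K := K) (d := d) hD hC hY
  refine ⟨hfin, ?_⟩
  set M := max (Y ^ d * |(NumberField.discr K : ℝ)| ^ (-(1 / 2) : ℝ)) (Y ^ ((d : ℝ) / 2)) with hM
  have hM0 : 0 ≤ M := le_max_of_le_right (by positivity)
  rcases (polynomialsCuttingOut K d D C Y).eq_empty_or_nonempty with hempty | hne
  · rw [fieldMultiplicity, hempty, Set.ncard_empty, Nat.cast_zero]
    positivity
  have hZ : 1 ≤ c * Y := one_le_of_nonempty_polynomialsCuttingOut hd hD hC hY hne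
  refine (Nat.cast_le.2 hle).trans ?_
  rcases (Submodule.finrank_le (Submodule.span ℚ (shortIntegers K (c * Y)))).lt_or_eq with
    hlt | heq
  -- The integers shorter than `c Y` lie in a proper subspace.
  · have hsq := ncard_shortIntegers_sq_le K hZ hlt
    rw [hK] at hsq
    have hpow : (c ^ ((d : ℝ) / 2) * Y ^ ((d : ℝ) / 2)) ^ 2 = (c * Y) ^ d := by
      rw [← Real.mul_rpow hc0.le hY.le, ← Real.rpow_natCast, ← Real.rpow_mul (by positivity),
        ← Real.rpow_natCast]
      congr 1
      push_cast
      ring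
    rw [← hpow, ← mul_pow] at hsq
    calc ((shortIntegers K (c * Y)).ncard : ℝ)
        ≤ 3 ^ d ^ 2 * (c ^ ((d : ℝ) / 2) * Y ^ ((d : ℝ) / 2)) :=
          le_of_sq_le_sq hsq (by positivity)
      _ = 3 ^ d ^ 2 * c ^ ((d : ℝ) / 2) * Y ^ ((d : ℝ) / 2) := by ring
      _ ≤ ((4 * ((d + 1) * c)) ^ d + 3 ^ d ^ 2 * c ^ ((d : ℝ) / 2)) * M := by
        gcongr
        · exact le_add_of_nonneg_left (by positivity)
        · exact le_max_right _ _
  -- The integers shorter than `c Y` span `K`.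
  · have hdisc : 0 < |(NumberField.discr K : ℝ)| :=
      abs_pos.2 (Int.cast_ne_zero.2 (NumberField.discr_ne_zero K))
    have hvol := ncard_shortIntegers_mul_sqrt_discr_le K (by positivity : 0 ≤ c * Y) heq
    rw [hK, ← le_div_iff₀ (Real.sqrt_pos.2 hdisc)] at hvol
    calc ((shortIntegers K (c * Y)).ncard : ℝ)
        ≤ (4 * ((d + 1) * (c * Y))) ^ d / √|(NumberField.discr K : ℝ)| := hvol
      _ = (4 * ((d + 1) * c)) ^ d * (Y ^ d * |(NumberField.discr K : ℝ)| ^ (-(1 / 2) : ℝ)) := by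
        rw [Real.rpow_neg hdisc.le, ← Real.sqrt_eq_rpow, ← mul_assoc (d + 1 : ℝ) c Y,
          ← mul_assoc 4 (((d : ℝ) + 1) * c) Y, mul_pow _ Y, div_eq_mul_inv, mul_assoc]
      _ ≤ ((4 * ((d + 1) * c)) ^ d + 3 ^ d ^ 2 * c ^ ((d : ℝ) / 2)) * M := by
        gcongr
        · exact le_add_of_nonneg_right (by positivity)
        · exact le_max_left _ _
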